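/- Let $W$ be uniform on $[0,1]$ and, given $W=w$, let $X^n=(X_1,\dots,X_n)$ be i.i.d. Bernoulli($w$), where $n\ge 1$. Let $$R_B=\inf_{\phi}\ \mathbb E\,|W-\phi(X^n)|$$ be the Bayesian risk for the absolute loss, the infimum being over all functions $\phi:\{0,1\}^n\to\mathbb R$. Let $\chi^2(W,X^n)=\int\left(\frac{dP_{WX^n}}{d(P_W\otimes P_{X^n})}-1\right)^2 d(P_W\otimes P_{X^n})$ be the $\chi^2$-mutual information, and let $$\mathcal L(W\!\to\! X^n)=\sup_{U-W-X^n-\hat U}\log\frac{\mathbb P(U=\hat U)}{\max_u \mathbb P(U=u)}$$ be the maximal leakage, the supremum being over all Markov chains $U-W-X^n-\hat U$ with $U,\hat U$ in a common finite alphabet. Then for every $n\ge 1$: 1. $\displaystyle \chi^2(W,X^n)+1=\frac{n+1}{2n+1}\cdot\frac{4^n}{\binom{2n}{n}}\le\frac{16\sqrt{\pi n}}{21}$; 2. $\displaystyle R_B\ \ge\ \frac{2}{27}\cdot\frac{1}{\chi^2(W,X^n)+1}\ \ge\ \frac{7}{72\sqrt{\pi n}}$; 3. $\displaystyle \mathcal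 L(W\!\to\! X^n)\le\log\left(2+\sqrt{\pi n/2}\right)$ and $\displaystyle R_B\ \ge\ \frac{1}{8\left(2+\sqrt{\pi n/2}\right)}$; 4. the sample mean $\hat W=\frac1n\sum_{i=1}^n X_i$ satisfies $\mathbb E|W-\hat W|\le \frac{1}{\sqrt{6n}}$, so that $\displaystyle R_B\le\frac{1}{\sqrt{6n}}$. Moreover, both lower bounds match the upper bound up to constants: there is a constant $c>0$, independent of $n$, such that for all $n\ge1$ $$\frac{7}{72\sqrt{\pi n}}\ge\frac{c}{\sqrt{6n}}\qquad\text{and}\qquad \frac{1}{8\left(2+\sqrt{\pi n/2}\right)}\ge\frac{c}{\sqrt{6n}}.$$ -/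

import Mathlib

open MeasureTheory ProbabilityTheory unitInterval
open scoped ENNReal

/-- The Bayesian risk `R_B = inf_φ E[ℓ(W, φ(X))]`, where `W ∼ π`, `X ∣ W = w ∼ P w`, and the
infimum is over all measurable (non-randomised) estimators `φ`. -/
noncomputable def bayesianRisk {Θ 𝓧 𝓨 : Type*} [MeasurableSpace Θ] [MeasurableSpace 𝓧]
    [MeasurableSpace 𝓨] (ℓ : Θ → 𝓨 → ℝ≥0∞) (π : Measure Θ) (P : Kernel Θ 𝓧) : ℝ≥0∞ :=
  ⨅ (φ : 𝓧 → 𝓨) (_ : Measurable φ), ∫⁻ z, ℓ z.1 (φ z.2) ∂(π ⊗ₘ P)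

open scoped Classical in
/-- Pearson's `χ²`-divergence `∫ (dμ/dν - 1)² dν` (infinite unless `μ ≪ ν`). -/
noncomputable def chiSqDiv {α : Type*} [MeasurableSpace α] (μ ν : Measure α) : ℝ≥0∞ :=
  if μ ≪ ν then ∫⁻ a, ENNReal.ofReal (((μ.rnDeriv ν a).toReal - 1) ^ 2) ∂ν else ∞

/-- The `χ²`-mutual information of a joint law: the `χ²`-divergence of the joint law from the
product of its marginals. -/
noncomputable def chiSqInfo {α β : Type*} [MeasurableSpace α] [MeasurableSpace β]
    (J : Measure (α × β)) : ℝ≥0∞ :=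
  chiSqDiv J (J.fst.prod J.snd)

/-- The maximal leakage from `W ∼ π` to `X` (with `X ∣ W = w ∼ P w`):
the supremum of `log (ℙ(U = Û) / max_u ℙ(U = u))` over all Markov chains `U - W - X - Û` with `U`
and `Û` in a common finite alphabet. Such a chain is given by the conditional law `K` of `U`
given `W` and the conditional law `D` of `Û` given `X`; given `W`, the variables `U` and `Û`
are independent with laws `K` and `D ∘ₖ P`. -/
noncomputable def maximalLeakage {Θ 𝓧 : Type*} [MeasurableSpace Θ] [MeasurableSpace 𝓧]
    (π : Measure Θ) (P : Kernel Θ 𝓧) : EReal :=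
  ⨆ (m : ℕ) (K : Kernel Θ (Fin m)) (_ : IsMarkovKernel K)
    (D : Kernel 𝓧 (Fin m)) (_ : IsMarkovKernel D),
    ENNReal.log ((((K ×ₖ (D ∘ₖ P)) ∘ₘ π) {p | p.1 = p.2}) / ⨆ u : Fin m, (K ∘ₘ π) {u})

instance isProbabilityMeasure_bernoulli_bool (w : I) :
    IsProbabilityMeasure (bernoulliMeasure true false w) :=
  ⟨bernoulliMeasure_apply_of_mem_of_mem w MeasurableSet.univ trivial trivial⟩

theorem measurable_pi_bernoulli (n : ℕ) :
    Measurable fun w : I => Measure.pi fun _ : Fin n => bernoulliMeasure true false w := by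
  have hs : ∀ b : Bool, Measurable fun w : I => bernoulliMeasure true false w {b} := by
    intro b
    cases b
    · simp only [bernoulliMeasure_def, Measure.add_apply, Measure.smul_apply]
      simp [ENNReal.smul_def]
      fun_prop
    · simp only [bernoulliMeasure_def, Measure.add_apply, Measure.smul_apply]
      simp [ENNReal.smul_def]
      fun_prop
  refine Measure.measurable_of_measurable_coe _ fun s _ => ?_
  have h : ∀ w : I, (Measure.pi fun _ : Fin n => bernoulliMeasure true false w) s
      = ∑ x ∈ s.toFinite.toFinset, ∏ i, bernoulliMeasure true false w {x i} := by
    intro w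
    have := sum_measure_singleton (s := s.toFinite.toFinset)
      (μ := Measure.pi fun _ : Fin n => bernoulliMeasure true false w)
    rw [Set.Finite.coe_toFinset] at this
    rw [← this]
    exact Finset.sum_congr rfl fun x _ => Measure.pi_singleton _ x
  simp only [h]
  exact Finset.measurable_sum _ fun x _ => Finset.measurable_prod _ fun i _ => hs (x i)

/-- The law of `X^n = (X_1, …, X_n)` given `W = w`: i.i.d. Bernoulli(`w`), with `true` as `1`. -/
noncomputable def bernoulliSamples (n : ℕ) : Kernel I (Fin n → Bool) where
  toFun w := Measure.pi fun _ => bernoulliMeasure true false w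
  measurable' := measurable_pi_bernoulli n

instance isMarkovKernel_bernoulliSamples (n : ℕ) : IsMarkovKernel (bernoulliSamples n) :=
  ⟨fun w => inferInstanceAs
    (IsProbabilityMeasure (Measure.pi fun _ : Fin n => bernoulliMeasure true false w))⟩

/-- The joint law of `(W, X^n)`, where `W` is uniform on `[0,1]`. -/
noncomputable def bernoulliJoint (n : ℕ) : Measure (I × (Fin n → Bool)) :=
  (volume : Measure I) ⊗ₘ bernoulliSamples n

/-- The loss `ℓ(w, ŵ) = |w - ŵ|`. -/
noncomputable def absLoss (w : I) (v : ℝ) : ℝ≥0∞ := ENNReal.ofReal |(w : ℝ) - v|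

/-- The sample mean `(X_1 + ⋯ + X_n) / n`. -/
noncomputable def sampleMean (n : ℕ) (x : Fin n → Bool) : ℝ :=
  (∑ i, if x i then (1 : ℝ) else 0) / n

/-- The Bayesian risk of estimating the bias `W` from `X^n` under the loss `|w - ŵ|`. -/
noncomputable def bernoulliRisk (n : ℕ) : ℝ≥0∞ :=
  bayesianRisk absLoss (volume : Measure I) (bernoulliSamples n)

/-!
For every threshold `ρ`, Markov's inequality bounds the risk of an estimator `φ` below by
`ρ * (1 - ℙ(ℓ(W, φ(X)) < ρ))`. If `W` and `X` were independent, the event `ℓ(W, φ(X)) < ρ` would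
have at most the small-ball probability of the prior. There are two ways to return to the true
joint law: the Cauchy-Schwarz inequality, at the price of a factor `χ² + 1` under a square root, or
the domination of all conditional laws `P w` by one measure `ν`, at the price of the factor
`ν univ`; the logarithm of `ν univ` also bounds the maximal leakage. Both bounds are then
optimised over `ρ`.

For Bernoulli samples with a uniform prior, Beta integrals turn `χ² + 1` into a multiple of the
convolution `∑ C(2k, k) C(2(n - k), n - k) = 4 ^ n`. The smallest `ν` has mass
`∑ C(n, k) (k / n) ^ k (1 - k / n) ^ (n - k)`. Its two extreme terms are `1`, and by Stirling's
formula the others are at most `√(n / 2π) / √(k (n - k))`, whose sum telescopes against increments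
of `arcsin`. The upper bound on the risk comes from the variance `w (1 - w) / n` of the sample
mean, averaged over `w`.
-/

theorem sq_lintegral_le_measure_univ_mul_lintegral_sq {α : Type*} [MeasurableSpace α]
    {μ : Measure α} {f : α → ℝ≥0∞} (hf : AEMeasurable f μ) :
    (∫⁻ a, f a ∂μ) ^ 2 ≤ μ Set.univ * ∫⁻ a, f a ^ 2 ∂μ := by
  have holder : ∫⁻ a, f a ∂μ ≤ μ Set.univ ^ (1 / 2 : ℝ) * (∫⁻ a, f a ^ 2 ∂μ) ^ (1 / 2 : ℝ) := by
    simpa using ENNReal.lintegral_mul_le_Lp_mul_Lq μ .two_two (aemeasurable_const (b := 1)) hf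
  calc (∫⁻ a, f a ∂μ) ^ 2
      ≤ (μ Set.univ ^ (1 / 2 : ℝ) * (∫⁻ a, f a ^ 2 ∂μ) ^ (1 / 2 : ℝ)) ^ 2 := by gcongr
    _ = μ Set.univ * ∫⁻ a, f a ^ 2 ∂μ := by
      rw [mul_pow, ← ENNReal.rpow_mul_natCast, ← ENNReal.rpow_mul_natCast]
      norm_num

section ChiSqDiv

variable {α : Type*} [MeasurableSpace α] {μ ν : Measure α}
  [IsProbabilityMeasure μ] [IsProbabilityMeasure ν]

theorem chiSqDiv_add_one_eq_lintegral_rnDeriv_sq (hμν : μ ≪ ν) :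
    chiSqDiv μ ν + 1 = ∫⁻ a, μ.rnDeriv ν a ^ 2 ∂ν := by
  have hf : Measurable (μ.rnDeriv ν) := Measure.measurable_rnDeriv μ ν
  have hmass : ∫⁻ a, μ.rnDeriv ν a ∂ν = 1 := by
    rw [Measure.lintegral_rnDeriv hμν, measure_univ]
  have hexpand : ∀ᵐ a ∂ν, ENNReal.ofReal (((μ.rnDeriv ν a).toReal - 1) ^ 2) +
      2 * μ.rnDeriv ν a = μ.rnDeriv ν a ^ 2 + 1 := by
    filter_upwards [μ.rnDeriv_ne_top ν] with a ha
    lift μ.rnDeriv ν a to NNReal using ha with y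
    rw [ENNReal.coe_toReal, ← ENNReal.ofReal_coe_nnreal, ← ENNReal.ofReal_pow y.coe_nonneg,
      ← ENNReal.ofReal_ofNat 2, ← ENNReal.ofReal_mul zero_le_two,
      ← ENNReal.ofReal_add (sq_nonneg _) (by positivity), ← ENNReal.ofReal_one,
      ← ENNReal.ofReal_add (by positivity) zero_le_one]
    congr 1
    ring
  have hint := lintegral_congr_ae hexpand
  rw [lintegral_add_right _ (hf.const_mul 2), lintegral_const_mul _ hf, hmass,
    lintegral_add_right _ measurable_const, lintegral_one, measure_univ, mul_one,
    show (2 : ℝ≥0∞) = 1 + 1 from one_add_one_eq_two.symm, ← add_assoc] at hint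
  rw [chiSqDiv, if_pos hμν]
  exact (ENNReal.add_left_inj ENNReal.one_ne_top).1 hint

theorem sq_measure_le_chiSqDiv_add_one_mul (hμν : μ ≪ ν) (s : Set α) :
    μ s ^ 2 ≤ (chiSqDiv μ ν + 1) * ν s := by
  calc μ s ^ 2 = (∫⁻ a in s, μ.rnDeriv ν a ∂ν) ^ 2 := by rw [Measure.setLIntegral_rnDeriv hμν]
    _ ≤ (ν.restrict s) Set.univ * ∫⁻ a in s, μ.rnDeriv ν a ^ 2 ∂ν :=
      sq_lintegral_le_measure_univ_mul_lintegral_sq (by fun_prop)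
    _ ≤ ν s * ∫⁻ a, μ.rnDeriv ν a ^ 2 ∂ν := by
      rw [Measure.restrict_apply_univ]
      gcongr
      exact Measure.restrict_le_self
    _ = (chiSqDiv μ ν + 1) * ν s := by
      rw [chiSqDiv_add_one_eq_lintegral_rnDeriv_sq hμν, mul_comm]

end ChiSqDiv

section InformationDensity

variable {Θ 𝓧 : Type*} [MeasurableSpace Θ] [MeasurableSpace 𝓧]

theorem ae_kernel_singleton_eq_zero [MeasurableSingletonClass 𝓧] {π : Measure Θ}
    {P : Kernel Θ 𝓧} {x : 𝓧} (hx : (P ∘ₘ π) {x} = 0) : ∀ᵐ w ∂π, P w {x} = 0 := by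
  rwa [Measure.bind_apply (measurableSet_singleton x) P.aemeasurable,
    lintegral_eq_zero_iff (P.measurable_coe (measurableSet_singleton x))] at hx

/-- The density of the joint law of `W ∼ π` and `X ∣ W = w ∼ P w` with respect to the product of
its marginals, for countably valued `X`: `P(x | w) / P(x)`. Where `P(x) = 0`, the value is `0` or
`∞`, but this happens on a null set only. -/
noncomputable def informationDensity (π : Measure Θ) (P : Kernel Θ 𝓧) (z : Θ × 𝓧) : ℝ≥0∞ :=
  P z.1 {z.2} / (P ∘ₘ π) {z.2}

variable [Countable 𝓧] [MeasurableSingletonClass 𝓧] (π : Measure Θ) (P : Kernel Θ 𝓧)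

theorem measurable_informationDensity : Measurable (informationDensity π P) :=
  measurable_from_prod_countable_left fun x =>
    (P.measurable_coe (measurableSet_singleton x)).div_const ((P ∘ₘ π) {x})

theorem compProd_eq_withDensity_informationDensity [IsFiniteMeasure π] [IsFiniteKernel P] :
    π ⊗ₘ P = (π.prod (P ∘ₘ π)).withDensity (informationDensity π P) := by
  have hd := measurable_informationDensity π P
  refine Measure.ext_of_lintegral _ fun f hf => ?_
  rw [lintegral_withDensity_eq_lintegral_mul _ hd hf, Measure.lintegral_compProd hf,
    lintegral_prod _ (hd.mul hf).aemeasurable]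
  have hnull : ∀ᵐ w ∂π, ∀ x, (P ∘ₘ π) {x} = 0 → P w {x} = 0 := by
    simp only [ae_all_iff]
    exact fun x hx => ae_kernel_singleton_eq_zero hx
  refine lintegral_congr_ae ?_
  filter_upwards [hnull] with w hw
  simp only [lintegral_countable', Pi.mul_apply, informationDensity]
  refine tsum_congr fun x => ?_
  rw [mul_right_comm, ENNReal.div_mul_cancel' (hw x) fun h => absurd h (measure_ne_top _ _),
    mul_comm]

theorem chiSqInfo_compProd_add_one_eq_tsum [IsProbabilityMeasure π] [IsMarkovKernel P] :
    chiSqInfo (π ⊗ₘ P) + 1 = ∑' x, (∫⁻ w, P w {x} ^ 2 ∂π) / (P ∘ₘ π) {x} := by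
  have hd := measurable_informationDensity π P
  have hJ := compProd_eq_withDensity_informationDensity π P
  have hac : π ⊗ₘ P ≪ π.prod (P ∘ₘ π) := hJ ▸ withDensity_absolutelyContinuous _ _
  have hrn : (π ⊗ₘ P).rnDeriv (π.prod (P ∘ₘ π)) =ᵐ[π.prod (P ∘ₘ π)] informationDensity π P := by
    conv_lhs => rw [hJ]
    exact Measure.rnDeriv_withDensity _ hd
  have hm (x : 𝓧) : Measurable fun w => P w {x} := P.measurable_coe (measurableSet_singleton x)
  calc chiSqInfo (π ⊗ₘ P) + 1
      = ∫⁻ z, informationDensity π P z ^ 2 ∂(π.prod (P ∘ₘ π)) := by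
        rw [chiSqInfo, Measure.fst_compProd, Measure.snd_compProd,
          chiSqDiv_add_one_eq_lintegral_rnDeriv_sq hac]
        exact lintegral_congr_ae (hrn.fun_comp (· ^ 2))
    _ = ∫⁻ z, informationDensity π P z ∂(π ⊗ₘ P) := by
        conv_rhs => rw [hJ, lintegral_withDensity_eq_lintegral_mul _ hd hd]
        simp only [sq, Pi.mul_apply]
    _ = ∑' x, ∫⁻ w, P w {x} ^ 2 / (P ∘ₘ π) {x} ∂π := by
        rw [Measure.lintegral_compProd hd, ← lintegral_tsum fun x =>
          (((hm x).pow_const 2).div_const _).aemeasurable]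
        simp only [lintegral_countable', informationDensity, sq, ENNReal.mul_div_right_comm]
    _ = ∑' x, (∫⁻ w, P w {x} ^ 2 ∂π) / (P ∘ₘ π) {x} := by
        simp only [div_eq_mul_inv, lintegral_mul_const _ ((hm _).pow_const 2)]

end InformationDensity

section RiskLowerBound

variable {Θ 𝓧 𝓨 : Type*} [MeasurableSpace Θ] [MeasurableSpace 𝓧] [MeasurableSpace 𝓨]

/-- The small-ball probability `sup_v ℙ(ℓ(W, v) < ρ)` of `W ∼ π`: the best chance of guessing `W`
within loss `ρ` without any observation. -/
noncomputable def smallBallProb (ℓ : Θ → 𝓨 → ℝ≥0∞) (π : Measure Θ) (ρ : ℝ≥0∞) : ℝ≥0∞ :=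
  ⨆ v, π {w | ℓ w v < ρ}

variable {ℓ : Θ → 𝓨 → ℝ≥0∞} {π : Measure Θ} {P : Kernel Θ 𝓧}

theorem measurable_loss_estimator (hℓ : Measurable (Function.uncurry ℓ)) {φ : 𝓧 → 𝓨}
    (hφ : Measurable φ) : Measurable fun z : Θ × 𝓧 => ℓ z.1 (φ z.2) :=
  hℓ.comp (measurable_fst.prodMk (hφ.comp measurable_snd))

theorem prod_loss_lt_le_smallBallProb_mul [SFinite π] (hℓ : Measurable (Function.uncurry ℓ))
    {φ : 𝓧 → 𝓨} (hφ : Measurable φ) (ν : Measure 𝓧) [SFinite ν] (ρ : ℝ≥0∞) :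
    (π.prod ν) {z | ℓ z.1 (φ z.2) < ρ} ≤ smallBallProb ℓ π ρ * ν Set.univ := by
  rw [Measure.prod_apply_symm
    (measurableSet_lt (measurable_loss_estimator hℓ hφ) measurable_const), ← lintegral_const]
  exact lintegral_mono fun x => le_iSup (fun v => π {w | ℓ w v < ρ}) (φ x)

theorem compProd_le_prod_of_forall_le [SFinite π] [IsSFiniteKernel P] {ν : Measure 𝓧}
    [SFinite ν] (hP : ∀ w, P w ≤ ν) : π ⊗ₘ P ≤ π.prod ν := by
  refine Measure.le_iff.2 fun s hs => ?_
  rw [Measure.compProd_apply hs, Measure.prod_apply hs]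
  exact lintegral_mono fun w => hP w _

variable [IsProbabilityMeasure π]

theorem mul_one_sub_le_bayesianRisk [IsMarkovKernel P] (hℓ : Measurable (Function.uncurry ℓ))
    {ρ δ : ℝ≥0∞}
    (h : ∀ φ : 𝓧 → 𝓨, Measurable φ → (π ⊗ₘ P) {z | ℓ z.1 (φ z.2) < ρ} ≤ δ) :
    ρ * (1 - δ) ≤ bayesianRisk ℓ π P := by
  refine le_iInf₂ fun φ hφ => ?_
  have hm := measurable_loss_estimator hℓ hφ
  calc ρ * (1 - δ) ≤ ρ * (1 - (π ⊗ₘ P) {z | ℓ z.1 (φ z.2) < ρ}) := by gcongr; exact h φ hφ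
    _ = ρ * (π ⊗ₘ P) {z | ρ ≤ ℓ z.1 (φ z.2)} := by
      rw [← prob_compl_eq_one_sub (measurableSet_lt hm measurable_const)]
      simp only [Set.compl_ofPred, not_lt]
    _ ≤ ∫⁻ z, ℓ z.1 (φ z.2) ∂(π ⊗ₘ P) := mul_meas_ge_le_lintegral hm ρ

theorem mul_one_sub_le_bayesianRisk_of_chiSqInfo [IsMarkovKernel P]
    (hℓ : Measurable (Function.uncurry ℓ)) (hac : π ⊗ₘ P ≪ π.prod (P ∘ₘ π)) {ρ δ : ℝ≥0∞}
    (hδ : (chiSqInfo (π ⊗ₘ P) + 1) * smallBallProb ℓ π ρ ≤ δ ^ 2) :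
    ρ * (1 - δ) ≤ bayesianRisk ℓ π P := by
  refine mul_one_sub_le_bayesianRisk hℓ fun φ hφ => ?_
  refine (ENNReal.pow_le_pow_left_iff two_ne_zero).1 ?_
  calc (π ⊗ₘ P) {z | ℓ z.1 (φ z.2) < ρ} ^ 2
      ≤ (chiSqDiv (π ⊗ₘ P) (π.prod (P ∘ₘ π)) + 1) *
          (π.prod (P ∘ₘ π)) {z | ℓ z.1 (φ z.2) < ρ} := sq_measure_le_chiSqDiv_add_one_mul hac _
    _ ≤ (chiSqInfo (π ⊗ₘ P) + 1) * smallBallProb ℓ π ρ := by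
      rw [chiSqInfo, Measure.fst_compProd, Measure.snd_compProd]
      gcongr
      simpa using prod_loss_lt_le_smallBallProb_mul hℓ hφ (P ∘ₘ π) ρ
    _ ≤ δ ^ 2 := hδ

theorem mul_one_sub_le_bayesianRisk_of_forall_le [IsMarkovKernel P]
    (hℓ : Measurable (Function.uncurry ℓ)) {ν : Measure 𝓧} [SFinite ν] (hP : ∀ w, P w ≤ ν)
    (ρ : ℝ≥0∞) :
    ρ * (1 - smallBallProb ℓ π ρ * ν Set.univ) ≤ bayesianRisk ℓ π P :=
  mul_one_sub_le_bayesianRisk hℓ fun _ hφ =>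
    (compProd_le_prod_of_forall_le hP _).trans (prod_loss_lt_le_smallBallProb_mul hℓ hφ ν ρ)

variable [IsMarkovKernel P] {c : ℝ≥0∞}

theorem div_chiSqInfo_add_one_le_bayesianRisk (hℓ : Measurable (Function.uncurry ℓ)) (hc : c ≠ 0)
    (hball : ∀ ρ, smallBallProb ℓ π ρ ≤ c * ρ) :
    ENNReal.ofReal (4 / 27) / (c * (chiSqInfo (π ⊗ₘ P) + 1)) ≤ bayesianRisk ℓ π P := by
  set C := c * (chiSqInfo (π ⊗ₘ P) + 1) with hC
  by_cases hac : π ⊗ₘ P ≪ π.prod (P ∘ₘ π)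
  swap
  · have htop : C = ∞ := by
      rw [hC, chiSqInfo, Measure.fst_compProd, Measure.snd_compProd, chiSqDiv, if_neg hac, top_add,
        ENNReal.mul_top hc]
    simp only [htop, ENNReal.div_top, zero_le]
  -- `ρ * (1 - √(C * ρ))` is maximal at `C * ρ = 4 / 9`.
  have hδ : (chiSqInfo (π ⊗ₘ P) + 1) * smallBallProb ℓ π (ENNReal.ofReal (4 / 9) / C)
      ≤ ENNReal.ofReal (2 / 3) ^ 2 := by
    calc (chiSqInfo (π ⊗ₘ P) + 1) * smallBallProb ℓ π (ENNReal.ofReal (4 / 9) / C)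
        ≤ (chiSqInfo (π ⊗ₘ P) + 1) * (c * (ENNReal.ofReal (4 / 9) / C)) := by gcongr; exact hball _
      _ = C * (ENNReal.ofReal (4 / 9) / C) := by rw [hC]; ring
      _ ≤ ENNReal.ofReal (4 / 9) := ENNReal.mul_div_le
      _ = ENNReal.ofReal (2 / 3) ^ 2 := by rw [← ENNReal.ofReal_pow (by norm_num)]; norm_num
  calc ENNReal.ofReal (4 / 27) / C
      = ENNReal.ofReal (4 / 9) / C * (1 - ENNReal.ofReal (2 / 3)) := by
        rw [← ENNReal.ofReal_one, ← ENNReal.ofReal_sub _ (by norm_num),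
          ← ENNReal.mul_div_right_comm, ← ENNReal.ofReal_mul (by norm_num)]
        norm_num
    _ ≤ bayesianRisk ℓ π P := mul_one_sub_le_bayesianRisk_of_chiSqInfo hℓ hac hδ

theorem inv_four_mul_measure_univ_le_bayesianRisk (hℓ : Measurable (Function.uncurry ℓ))
    (hball : ∀ ρ, smallBallProb ℓ π ρ ≤ c * ρ) {ν : Measure 𝓧} [SFinite ν]
    (hP : ∀ w, P w ≤ ν) : (4 * (c * ν Set.univ))⁻¹ ≤ bayesianRisk ℓ π P := by
  set M := c * ν Set.univ with hM
  -- `ρ * (1 - M * ρ)` is maximal at `M * ρ = 1 / 2`.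
  have hhalf : smallBallProb ℓ π (2⁻¹ / M) * ν Set.univ ≤ 2⁻¹ := by
    calc smallBallProb ℓ π (2⁻¹ / M) * ν Set.univ
        ≤ c * (2⁻¹ / M) * ν Set.univ := by gcongr; exact hball _
      _ = M * (2⁻¹ / M) := by rw [hM]; ring
      _ ≤ 2⁻¹ := ENNReal.mul_div_le
  calc (4 * M)⁻¹ = 2⁻¹ / M * (1 - 2⁻¹) := by
        rw [ENNReal.one_sub_inv_two, ← ENNReal.mul_div_right_comm,
          ← ENNReal.mul_inv (by simp) (by simp), ENNReal.mul_inv (by simp) (by simp),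
          div_eq_mul_inv]
        norm_num
    _ ≤ 2⁻¹ / M * (1 - smallBallProb ℓ π (2⁻¹ / M) * ν Set.univ) := by gcongr
    _ ≤ bayesianRisk ℓ π P := mul_one_sub_le_bayesianRisk_of_forall_le hℓ hP _

end RiskLowerBound

section MaximalLeakage

variable {Θ 𝓧 : Type*} [MeasurableSpace Θ] [MeasurableSpace 𝓧]

theorem comp_prod_diagonal {𝓤 : Type*} [Fintype 𝓤] [MeasurableSpace 𝓤] [MeasurableSingletonClass 𝓤]
    (π : Measure Θ) (K L : Kernel Θ 𝓤) [IsSFiniteKernel K] [IsSFiniteKernel L] :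
    ((K ×ₖ L) ∘ₘ π) {p | p.1 = p.2} = ∑ u, ∫⁻ w, K w {u} * L w {u} ∂π := by
  have hdiag : MeasurableSet {p : 𝓤 × 𝓤 | p.1 = p.2} := .of_discrete
  have hm (N : Kernel Θ 𝓤) (u : 𝓤) : Measurable fun w => N w {u} :=
    N.measurable_coe (measurableSet_singleton u)
  rw [Measure.bind_apply hdiag (Kernel.aemeasurable _),
    ← lintegral_finsetSum _ fun u _ =>
      show Measurable fun w => K w {u} * L w {u} from (hm K u).mul (hm L u)]
  refine lintegral_congr fun w => ?_
  rw [Kernel.prod_apply' _ _ _ hdiag, lintegral_fintype]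
  simp [Set.ofPred_eq_eq_singleton', mul_comm]

theorem maximalLeakage_le_log_measure_univ {π : Measure Θ} {P : Kernel Θ 𝓧} [IsSFiniteKernel P]
    {ν : Measure 𝓧} (hP : ∀ w, P w ≤ ν) :
    maximalLeakage π P ≤ ENNReal.log (ν Set.univ) := by
  refine iSup_le fun m => iSup_le fun K => iSup_le fun _ => iSup_le fun D => iSup_le fun _ =>
    ENNReal.log_le_log (ENNReal.div_le_of_le_mul ?_)
  have hcomp (w : Θ) (u : Fin m) : (D ∘ₖ P) w {u} ≤ (D ∘ₘ ν) {u} := by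
    rw [Kernel.comp_apply, Measure.bind_apply (measurableSet_singleton u) D.aemeasurable,
      Measure.bind_apply (measurableSet_singleton u) D.aemeasurable]
    exact lintegral_mono' (hP w) le_rfl
  have hmass : ∑ u, (D ∘ₘ ν) {u} = ν Set.univ := by
    rw [sum_measure_singleton, Finset.coe_univ, Measure.bind_apply .univ D.aemeasurable]
    simp only [measure_univ, lintegral_one]
  calc ((K ×ₖ (D ∘ₖ P)) ∘ₘ π) {p | p.1 = p.2}
      = ∑ u, ∫⁻ w, K w {u} * (D ∘ₖ P) w {u} ∂π := comp_prod_diagonal π K (D ∘ₖ P)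
    _ ≤ ∑ u, (K ∘ₘ π) {u} * (D ∘ₘ ν) {u} := by
      refine Finset.sum_le_sum fun u _ => ?_
      rw [Measure.bind_apply (m := π) (measurableSet_singleton u) K.aemeasurable,
        ← lintegral_mul_const _ (K.measurable_coe (measurableSet_singleton u))]
      exact lintegral_mono fun w => mul_le_mul_right (hcomp w u) _
    _ ≤ ∑ u, (⨆ u, (K ∘ₘ π) {u}) * (D ∘ₘ ν) {u} := by
      gcongr with u
      exact le_iSup (fun u => (K ∘ₘ π) {u}) u
    _ = ν Set.univ * ⨆ u, (K ∘ₘ π) {u} := by rw [← Finset.mul_sum, hmass, mul_comm]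

end MaximalLeakage

theorem le_sum_smul_dirac {α : Type*} [MeasurableSpace α] [Countable α]
    [MeasurableSingletonClass α] {μ : Measure α} {g : α → ℝ≥0∞} (h : ∀ a, μ {a} ≤ g a) :
    μ ≤ Measure.sum fun a => g a • Measure.dirac a := by
  refine Measure.le_iff.2 fun s hs => ?_
  rw [← μ.sum_smul_dirac, Measure.sum_apply _ hs, Measure.sum_apply _ hs]
  refine ENNReal.tsum_le_tsum fun a => ?_
  simp only [Measure.smul_apply, smul_eq_mul]
  gcongr
  exact h a

section CentralBinom

open Finset

theorem two_mul_sum_antidiagonal_fst_mul_of_symm {f : ℕ × ℕ → ℕ} (hf : ∀ p, f p.swap = f p)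
    (n : ℕ) : 2 * ∑ p ∈ antidiagonal n, p.1 * f p = n * ∑ p ∈ antidiagonal n, f p := by
  have hswap : ∑ p ∈ antidiagonal n, p.1 * f p = ∑ p ∈ antidiagonal n, p.2 * f p := by
    rw [← Nat.sum_antidiagonal_swap]
    simp only [Prod.fst_swap, hf]
  calc 2 * ∑ p ∈ antidiagonal n, p.1 * f p
      = ∑ p ∈ antidiagonal n, (p.1 + p.2) * f p := by
        simp only [two_mul, add_mul, sum_add_distrib]
        rw [← hswap]
    _ = n * ∑ p ∈ antidiagonal n, f p := by
        rw [mul_sum]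
        exact sum_congr rfl fun p hp => by rw [mem_antidiagonal.1 hp]

theorem sum_antidiagonal_centralBinom_mul_centralBinom (n : ℕ) :
    ∑ p ∈ antidiagonal n, p.1.centralBinom * p.2.centralBinom = 4 ^ n := by
  set c : ℕ × ℕ → ℕ := fun p => p.1.centralBinom * p.2.centralBinom with hc
  have hsymm (m : ℕ) := two_mul_sum_antidiagonal_fst_mul_of_symm
    (f := c) (fun p => mul_comm _ _) m
  induction n with
  | zero => simp [hc]
  | succ n ih =>
    have hshift : ∑ p ∈ antidiagonal (n + 1), p.1 * c p =
        ∑ p ∈ antidiagonal n, (2 * (2 * (p.1 * c p)) + 2 * c p) := by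
      rw [Nat.sum_antidiagonal_succ]
      simp only [zero_mul, zero_add, hc, ← mul_assoc, Nat.succ_mul_centralBinom_succ]
      exact sum_congr rfl fun p _ => by ring
    refine Nat.eq_of_mul_eq_mul_left n.succ_pos ?_
    rw [Nat.succ_eq_add_one, ← hsymm (n + 1), hshift, sum_add_distrib, ← mul_sum, ← mul_sum,
      ← mul_sum, hsymm n, ih]
    ring

theorem cast_centralBinom_eq_div (k : ℕ) :
    (k.centralBinom : ℝ) = (2 * k).factorial / (k.factorial * k.factorial) := by
  rw [Nat.centralBinom, Nat.cast_choose ℝ (Nat.le_mul_of_pos_left k two_pos), two_mul,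
    Nat.add_sub_cancel]

theorem sum_choose_mul_factorial_div (n : ℕ) :
    ∑ k ∈ range (n + 1), (n.choose k : ℝ) *
      (((2 * k).factorial * (2 * (n - k)).factorial / (2 * n + 1).factorial : ℝ) /
        (k.factorial * (n - k).factorial / (n + 1).factorial)) =
      ((n : ℝ) + 1) / (2 * n + 1) * (4 ^ n / ((2 * n).choose n : ℝ)) := by
  have hconv : (4 : ℝ) ^ n =
      ∑ k ∈ range (n + 1), (k.centralBinom : ℝ) * ((n - k).centralBinom : ℝ) := by
    rw [← Nat.sum_antidiagonal_eq_sum_range_succ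
      (fun i j => (i.centralBinom : ℝ) * (j.centralBinom : ℝ))]
    exact_mod_cast (sum_antidiagonal_centralBinom_mul_centralBinom n).symm
  rw [hconv, ← Nat.centralBinom_eq_two_mul_choose, sum_div, mul_sum]
  refine sum_congr rfl fun k hk => ?_
  simp only [cast_centralBinom_eq_div, Nat.cast_choose ℝ (mem_range_succ_iff.1 hk),
    Nat.factorial_succ]
  push_cast
  have := Nat.factorial_ne_zero
  field_simp

theorem succ_div_mul_four_pow_div_choose_le_sqrt {n : ℕ} (hn : 1 ≤ n) :
    ((n : ℝ) + 1) / (2 * n + 1) * (4 ^ n / ((2 * n).choose n : ℝ)) ≤ 4 / 3 * √n := by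
  rw [← Nat.centralBinom_eq_two_mul_choose]
  induction n, hn using Nat.le_induction with
  | base => norm_num [Nat.centralBinom, Nat.choose]
  | succ n hn ih =>
    have hpos : (0 : ℝ) < n.centralBinom := by exact_mod_cast n.centralBinom_pos
    have hrec : ((n + 1).centralBinom : ℝ) = 2 * (2 * n + 1) * n.centralBinom / (n + 1) := by
      rw [eq_div_iff (by positivity), mul_comm]
      exact_mod_cast n.succ_mul_centralBinom_succ
    have hsqrt : √n * (2 * (n + 2) / (2 * n + 3)) ≤ √((n + 1 : ℕ) : ℝ) := by
      refine Real.le_sqrt_of_sq_le ?_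
      rw [mul_pow, Real.sq_sqrt (by positivity), div_pow, mul_div_assoc',
        div_le_iff₀ (by positivity)]
      push_cast
      have hn' : (1 : ℝ) ≤ n := by exact_mod_cast hn
      nlinarith
    calc (((n + 1 : ℕ) : ℝ) + 1) / (2 * ((n + 1 : ℕ) : ℝ) + 1) *
          (4 ^ (n + 1) / ((n + 1).centralBinom : ℝ))
        = ((n : ℝ) + 1) / (2 * n + 1) * (4 ^ n / (n.centralBinom : ℝ)) *
            (2 * (n + 2) / (2 * n + 3)) := by
          rw [hrec]
          push_cast
          rw [show 2 * ((n : ℝ) + 1) + 1 = 2 * n + 3 by ring]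
          field_simp
          ring
      _ ≤ 4 / 3 * √n * (2 * (n + 2) / (2 * n + 3)) := by gcongr
      _ ≤ 4 / 3 * √((n + 1 : ℕ) : ℝ) := by
          rw [mul_assoc]
          gcongr

theorem succ_div_mul_four_pow_div_choose_le {n : ℕ} (hn : 1 ≤ n) :
    ((n : ℝ) + 1) / (2 * n + 1) * (4 ^ n / ((2 * n).choose n : ℝ)) ≤
      16 * √(Real.pi * n) / 21 := by
  have hπ : 7 / 4 ≤ √Real.pi := Real.le_sqrt_of_sq_le (by linarith [Real.pi_gt_d2])
  calc ((n : ℝ) + 1) / (2 * n + 1) * (4 ^ n / ((2 * n).choose n : ℝ))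
      ≤ 4 / 3 * √n := succ_div_mul_four_pow_div_choose_le_sqrt hn
    _ = 16 / 21 * (7 / 4 * √n) := by ring
    _ ≤ 16 / 21 * (√Real.pi * √n) := by gcongr
    _ = 16 * √(Real.pi * n) / 21 := by rw [Real.sqrt_mul Real.pi_pos.le]; ring

end CentralBinom

section PeakLikelihood

/-- The likelihood `w ^ k * (1 - w) ^ l` of `k` successes and `l` failures at its maximum over
`w ∈ [0, 1]`, attained at `w = k / (k + l)`. -/
noncomputable def peakLikelihood (k l : ℕ) : ℝ :=
  ((k : ℝ) / (k + l)) ^ k * ((l : ℝ) / (k + l)) ^ l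

theorem peakLikelihood_nonneg (k l : ℕ) : 0 ≤ peakLikelihood k l := by
  unfold peakLikelihood
  positivity

theorem peakLikelihood_zero_left (l : ℕ) : peakLikelihood 0 l = 1 := by
  rcases eq_or_ne l 0 with rfl | hl <;> simp [peakLikelihood, *]

theorem peakLikelihood_zero_right (k : ℕ) : peakLikelihood k 0 = 1 := by
  rcases eq_or_ne k 0 with rfl | hk <;> simp [peakLikelihood, *]

theorem pow_mul_one_sub_pow_le_peakLikelihood (k l : ℕ) (w : I) :
    (w : ℝ) ^ k * (1 - w) ^ l ≤ peakLikelihood k l := by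
  have hw₀ := w.2.1
  have hw₁ := sub_nonneg.2 w.2.2
  rcases eq_or_ne k 0 with rfl | hk
  · simpa only [pow_zero, one_mul, peakLikelihood_zero_left] using
      pow_le_one₀ hw₁ (sub_le_self 1 hw₀)
  rcases eq_or_ne l 0 with rfl | hl
  · simpa only [pow_zero, mul_one, peakLikelihood_zero_right] using pow_le_one₀ hw₀ w.2.2
  set p : ℝ := k / (k + l) with hp
  set q : ℝ := l / (k + l) with hq
  have hpq : p + q = 1 := by rw [hp, hq]; field_simp
  -- Weighted AM-GM for `w / p` and `(1 - w) / q`, whose weighted mean is `1`.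
  have hamgm : (w / p) ^ p * ((1 - w) / q) ^ q ≤ 1 := by
    refine (Real.geom_mean_le_arith_mean2_weighted (by positivity) (by positivity)
      (by positivity) (by positivity) hpq).trans_eq ?_
    rw [mul_div_cancel₀ _ (by positivity), mul_div_cancel₀ _ (by positivity), add_sub_cancel]
  have hpow : (w / p) ^ k * ((1 - w) / q) ^ l ≤ 1 := by
    have h := pow_le_one₀ (n := k + l) (by positivity) hamgm
    rwa [mul_pow, ← Real.rpow_mul_natCast (by positivity), ← Real.rpow_mul_natCast (by positivity),
      Nat.cast_add, hp, hq, div_mul_cancel₀ _ (by positivity), div_mul_cancel₀ _ (by positivity),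
      Real.rpow_natCast, Real.rpow_natCast] at h
  rw [div_pow _ p, div_pow _ q, div_mul_div_comm] at hpow
  exact (div_le_one₀ (show 0 < p ^ k * q ^ l by positivity)).1 hpow

theorem factorial_eq_stirlingSeq_mul {n : ℕ} (hn : n ≠ 0) :
    (n.factorial : ℝ) = Stirling.stirlingSeq n * (√(2 * n) * (n / Real.exp 1) ^ n) := by
  rw [Stirling.stirlingSeq, div_mul_cancel₀ _ (by positivity)]

theorem choose_mul_peakLikelihood_eq_stirlingSeq {k l : ℕ} (hk : k ≠ 0) (hl : l ≠ 0) :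
    ((k + l).choose k : ℝ) * peakLikelihood k l =
      Stirling.stirlingSeq (k + l) / (Stirling.stirlingSeq k * Stirling.stirlingSeq l) *
        (√((k + l) / 2) * (1 / √(k * l))) := by
  rw [Nat.cast_choose ℝ (Nat.le_add_right k l), Nat.add_sub_cancel_left,
    factorial_eq_stirlingSeq_mul hk, factorial_eq_stirlingSeq_mul hl,
    factorial_eq_stirlingSeq_mul (by lia : k + l ≠ 0), peakLikelihood]
  have hsqrt : √(2 * (k + l)) / (√(2 * k) * √(2 * l)) = √((k + l) / 2) * (1 / √(k * l)) := by
    rw [← Real.sqrt_mul (by positivity), ← Real.sqrt_div (by positivity), mul_one_div,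
      ← Real.sqrt_div (by positivity)]
    congr 1
    field_simp
  rw [← hsqrt]
  push_cast
  simp only [div_pow, pow_add]
  field_simp

theorem choose_mul_peakLikelihood_le {k l : ℕ} (hk : k ≠ 0) (hl : l ≠ 0) :
    ((k + l).choose k : ℝ) * peakLikelihood k l ≤
      √((k + l) / (2 * Real.pi)) * (1 / √(k * l)) := by
  obtain ⟨i, rfl⟩ := Nat.exists_eq_succ_of_ne_zero hk
  have hpos : 0 < Stirling.stirlingSeq i.succ := Stirling.stirlingSeq'_pos i
  have hanti : Stirling.stirlingSeq (i.succ + l) ≤ Stirling.stirlingSeq i.succ := by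
    rw [Nat.succ_add]
    exact Stirling.stirlingSeq'_antitone (Nat.le_add_right i l)
  have hπ : √Real.pi ≤ Stirling.stirlingSeq l := Stirling.sqrt_pi_le_stirlingSeq hl
  have hratio : Stirling.stirlingSeq (i.succ + l) /
      (Stirling.stirlingSeq i.succ * Stirling.stirlingSeq l) ≤ 1 / √Real.pi := by
    rw [← div_div]
    gcongr
    exact div_le_one_of_le₀ hanti hpos.le
  calc ((i.succ + l).choose i.succ : ℝ) * peakLikelihood i.succ l
      ≤ 1 / √Real.pi * (√((i.succ + l) / 2) * (1 / √(i.succ * l))) := by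
        rw [choose_mul_peakLikelihood_eq_stirlingSeq hk hl]
        gcongr
    _ = √((i.succ + l) / (2 * Real.pi)) * (1 / √(i.succ * l)) := by
        rw [← div_div _ 2 Real.pi, Real.sqrt_div' _ Real.pi_pos.le]
        ring

theorem sub_le_sqrt_mul_arcsin_sub {u v : ℝ} (hu : -1 ≤ u) (huv : u ≤ v) (hv : v ≤ 1) :
    v - u ≤ √(1 - ((u + v) / 2) ^ 2) * (Real.arcsin v - Real.arcsin u) := by
  set α := Real.arcsin u
  set β := Real.arcsin v
  have hαβ : α ≤ β := Real.arcsin_le_arcsin huv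
  have hsin : u = Real.sin α ∧ v = Real.sin β :=
    ⟨(Real.sin_arcsin hu (huv.trans hv)).symm, (Real.sin_arcsin (hu.trans huv) hv).symm⟩
  have hdiff : v - u = 2 * Real.sin ((β - α) / 2) * Real.cos ((β + α) / 2) := by
    rw [hsin.1, hsin.2, Real.sin_sub_sin]
  have hmean : (u + v) / 2 = Real.sin ((β + α) / 2) * Real.cos ((β - α) / 2) := by
    have h := Real.sin_sub_sin β (-α)
    rw [Real.sin_neg, sub_neg_eq_add, sub_neg_eq_add, ← sub_eq_add_neg] at h
    rw [hsin.1, hsin.2, add_comm, h]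
    ring
  have hcos : Real.cos ((β + α) / 2) ≤ √(1 - ((u + v) / 2) ^ 2) := by
    refine Real.le_sqrt_of_sq_le ?_
    rw [hmean, mul_pow]
    nlinarith [Real.sin_sq_add_cos_sq ((β + α) / 2), Real.cos_sq_le_one ((β - α) / 2),
      sq_nonneg (Real.sin ((β + α) / 2))]
  have hcos₀ : 0 ≤ Real.cos ((β + α) / 2) := Real.cos_nonneg_of_mem_Icc
    ⟨by linarith [Real.neg_pi_div_two_le_arcsin u, Real.neg_pi_div_two_le_arcsin v],
      by linarith [Real.arcsin_le_pi_div_two u, Real.arcsin_le_pi_div_two v]⟩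
  have hsin_le : 2 * Real.sin ((β - α) / 2) ≤ β - α := by
    linarith [Real.sin_le (show 0 ≤ (β - α) / 2 by linarith)]
  calc v - u ≤ (β - α) * √(1 - ((u + v) / 2) ^ 2) := by
        rw [hdiff]
        exact mul_le_mul hsin_le hcos hcos₀ (sub_nonneg.2 hαβ)
    _ = √(1 - ((u + v) / 2) ^ 2) * (β - α) := mul_comm _ _

theorem one_div_sqrt_mul_le_arcsin_sub {k l : ℝ} (hk : 1 ≤ k) (hl : 1 ≤ l) :
    1 / √(k * l) ≤
      Real.arcsin ((k - l + 1) / (k + l)) - Real.arcsin ((k - l - 1) / (k + l)) := by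
  have hs : 0 < k + l := by linarith
  have h := sub_le_sqrt_mul_arcsin_sub (u := (k - l - 1) / (k + l)) (v := (k - l + 1) / (k + l))
    (by rw [le_div_iff₀ hs]; linarith) (by gcongr; linarith) (by rw [div_le_one₀ hs]; linarith)
  have hsub : (k - l + 1) / (k + l) - (k - l - 1) / (k + l) = 2 / (k + l) := by ring
  have hsqrt : √(1 - (((k - l - 1) / (k + l) + (k - l + 1) / (k + l)) / 2) ^ 2) =
      2 / (k + l) * √(k * l) := by
    rw [← Real.sqrt_sq (show 0 ≤ 2 / (k + l) by positivity), ← Real.sqrt_mul (sq_nonneg _)]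
    congr 1
    field_simp
    ring
  rw [hsub, hsqrt, mul_assoc] at h
  rw [div_le_iff₀' (by positivity)]
  exact le_of_mul_le_mul_left (by simpa only [mul_one] using h) (by positivity)

theorem sum_one_div_sqrt_mul_le_pi {n : ℕ} (hn : 1 ≤ n) :
    ∑ k ∈ Finset.Ico 1 n, 1 / √((k : ℝ) * (n - k : ℕ)) ≤ Real.pi := by
  set θ : ℕ → ℝ := fun k => Real.arcsin ((2 * k - n - 1) / n)
  have hle : ∀ k ∈ Finset.Ico 1 n, 1 / √((k : ℝ) * (n - k : ℕ)) ≤ θ (k + 1) - θ k := by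
    intro k hk
    obtain ⟨hk, hkn⟩ := Finset.mem_Ico.1 hk
    rw [Nat.cast_sub hkn.le]
    convert! one_div_sqrt_mul_le_arcsin_sub (k := k) (l := n - k) (by exact_mod_cast hk)
      (by rw [le_sub_iff_add_le']; exact_mod_cast hkn) using 3 <;>
    · push_cast
      ring
  calc ∑ k ∈ Finset.Ico 1 n, 1 / √((k : ℝ) * (n - k : ℕ))
      ≤ ∑ k ∈ Finset.Ico 1 n, (θ (k + 1) - θ k) := Finset.sum_le_sum hle
    _ = θ n - θ 1 := Finset.sum_Ico_sub θ hn
    _ ≤ Real.pi / 2 - -(Real.pi / 2) :=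
      sub_le_sub (Real.arcsin_le_pi_div_two _) (Real.neg_pi_div_two_le_arcsin _)
    _ = Real.pi := by ring

theorem sum_choose_mul_peakLikelihood_le {n : ℕ} (hn : 1 ≤ n) :
    ∑ k ∈ Finset.range (n + 1), (n.choose k : ℝ) * peakLikelihood k (n - k) ≤
      2 + √(Real.pi * n / 2) := by
  have hterm : ∀ k ∈ Finset.Ico 1 n, (n.choose k : ℝ) * peakLikelihood k (n - k) ≤
      √(n / (2 * Real.pi)) * (1 / √((k : ℝ) * (n - k : ℕ))) := by
    intro k hk
    obtain ⟨hk, hkn⟩ := Finset.mem_Ico.1 hk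
    have h := choose_mul_peakLikelihood_le (k := k) (l := n - k) (by lia) (by lia)
    rwa [Nat.add_sub_cancel' hkn.le, ← Nat.cast_add, Nat.add_sub_cancel' hkn.le] at h
  have hbulk : ∑ k ∈ Finset.Ico 1 n, (n.choose k : ℝ) * peakLikelihood k (n - k) ≤
      √(Real.pi * n / 2) := by
    calc ∑ k ∈ Finset.Ico 1 n, (n.choose k : ℝ) * peakLikelihood k (n - k)
        ≤ √(n / (2 * Real.pi)) * ∑ k ∈ Finset.Ico 1 n, 1 / √((k : ℝ) * (n - k : ℕ)) := by
          rw [Finset.mul_sum]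
          exact Finset.sum_le_sum hterm
      _ ≤ √(n / (2 * Real.pi)) * √(Real.pi ^ 2) := by
          rw [Real.sqrt_sq Real.pi_pos.le]
          gcongr
          exact sum_one_div_sqrt_mul_le_pi hn
      _ = √(Real.pi * n / 2) := by
          rw [← Real.sqrt_mul (by positivity)]
          congr 1
          field_simp
  rw [Finset.sum_range_succ, Finset.range_eq_Ico, Finset.sum_eq_sum_Ico_succ_bot hn]
  simp only [Nat.choose_zero_right, Nat.choose_self, Nat.sub_zero, Nat.sub_self,
    peakLikelihood_zero_left, peakLikelihood_zero_right, Nat.cast_one, mul_one, zero_add]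
  linarith

end PeakLikelihood

theorem beta_natCast_add_one (a b : ℕ) :
    beta (a + 1) (b + 1) = a.factorial * b.factorial / (a + b + 1).factorial := by
  have hsum : (a + 1 + (b + 1) : ℝ) = ((a + b + 1 : ℕ) : ℝ) + 1 := by push_cast; ring
  rw [beta, hsum, Real.Gamma_nat_eq_factorial, Real.Gamma_nat_eq_factorial,
    Real.Gamma_nat_eq_factorial]

theorem lintegral_pow_mul_one_sub_pow (a b : ℕ) :
    ∫⁻ w : I, ENNReal.ofReal ((w : ℝ) ^ a * (1 - w) ^ b) =
      ENNReal.ofReal (a.factorial * b.factorial / (a + b + 1).factorial) := by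
  have ha : (0 : ℝ) < a + 1 := by positivity
  have hb : (0 : ℝ) < b + 1 := by positivity
  have hB := beta_pos ha hb
  have hpdf : ∫⁻ x in Set.Ioo (0 : ℝ) 1, ENNReal.ofReal (1 / beta (a + 1) (b + 1)) *
      ENNReal.ofReal (x ^ a * (1 - x) ^ b) = 1 := by
    rw [← lintegral_betaPDF_eq_one ha hb, lintegral_betaPDF]
    simp only [add_sub_cancel_right, Real.rpow_natCast, mul_assoc,
      ← ENNReal.ofReal_mul (one_div_nonneg.2 hB.le)]
  rw [lintegral_const_mul _ (by fun_prop), mul_comm] at hpdf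
  rw [unitInterval.volume_def, lintegral_subtype_comap measurableSet_Icc
    (fun w : ℝ => ENNReal.ofReal (w ^ a * (1 - w) ^ b)), ← restrict_Ioo_eq_restrict_Icc,
    ← beta_natCast_add_one, ENNReal.eq_inv_of_mul_eq_one_left hpdf, one_div,
    ENNReal.ofReal_inv_of_pos hB, inv_inv]

section BernoulliModel

theorem smallBallProb_absLoss_volume_le (ρ : ℝ≥0∞) :
    smallBallProb absLoss volume ρ ≤ 2 * ρ := by
  refine iSup_le fun v => ?_
  rw [unitInterval.volume_apply, ← Real.volume_eball v ρ]
  refine measure_mono ?_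
  rintro _ ⟨w, hw, rfl⟩
  rw [Metric.mem_eball, edist_dist, Real.dist_eq]
  exact hw

theorem measurable_uncurry_absLoss : Measurable (Function.uncurry absLoss) := by
  unfold absLoss Function.uncurry
  fun_prop

/-- The number of successes `true` in a sample. -/
def successCount {n : ℕ} (x : Fin n → Bool) : ℕ :=
  (Finset.univ.filter fun i => x i = true).card

/-- The likelihood `ℙ(X = x | W = w)` of the bias `w` given the sample `x`. -/
noncomputable def likelihood {n : ℕ} (x : Fin n → Bool) (w : I) : ℝ :=
  (w : ℝ) ^ successCount x * (1 - w) ^ (n - successCount x)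

variable {n : ℕ}

theorem successCount_le (x : Fin n → Bool) : successCount x ≤ n :=
  (Finset.card_le_univ _).trans_eq (Fintype.card_fin n)

theorem sum_successCount {M : Type*} [AddCommMonoid M] (n : ℕ) (f : ℕ → M) :
    ∑ x : Fin n → Bool, f (successCount x) = ∑ k ∈ Finset.range (n + 1), n.choose k • f k := by
  have h := Finset.sum_powerset_apply_card f (x := (Finset.univ : Finset (Fin n)))
  rw [Finset.card_univ, Fintype.card_fin] at h
  rw [← h, Finset.powerset_univ]
  refine Finset.sum_nbij' (fun x => Finset.univ.filter fun i => x i = true)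
    (fun s i => decide (i ∈ s)) ?_ ?_ ?_ ?_ ?_ <;> simp [successCount]

theorem likelihood_nonneg (x : Fin n → Bool) (w : I) : 0 ≤ likelihood x w :=
  mul_nonneg (pow_nonneg w.2.1 _) (pow_nonneg (sub_nonneg.2 w.2.2) _)

theorem prod_ite_eq_likelihood (x : Fin n → Bool) (w : I) :
    ∏ i, (if x i = true then (w : ℝ) else 1 - w) = likelihood x w := by
  have hcard : (Finset.univ.filter fun i => ¬ x i = true).card = n - successCount x := by
    rw [← Finset.compl_filter, Finset.card_compl, Fintype.card_fin, successCount]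
  rw [Finset.prod_ite, Finset.prod_const, Finset.prod_const, hcard, likelihood, successCount]

theorem bernoulliMeasure_true_false_singleton (w : I) (b : Bool) :
    bernoulliMeasure true false w {b} = ENNReal.ofReal (if b = true then (w : ℝ) else 1 - w) := by
  classical
  rw [bernoulliMeasure_apply _ (measurableSet_singleton b)]
  cases b <;> simp [ENNReal.ofReal, Real.toNNReal_of_nonneg w.2.1,
    Real.toNNReal_of_nonneg (sub_nonneg.2 w.2.2)] <;> rfl

theorem bernoulliSamples_singleton (x : Fin n → Bool) (w : I) :
    bernoulliSamples n w {x} = ENNReal.ofReal (likelihood x w) := by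
  change Measure.pi (fun _ : Fin n => bernoulliMeasure true false w) {x} = _
  rw [Measure.pi_singleton, ← prod_ite_eq_likelihood, ENNReal.ofReal_prod_of_nonneg]
  · simp only [bernoulliMeasure_true_false_singleton]
  · intro i _
    split_ifs
    exacts [w.2.1, sub_nonneg.2 w.2.2]

theorem lintegral_likelihood_pow (x : Fin n → Bool) (m : ℕ) :
    ∫⁻ w, ENNReal.ofReal (likelihood x w ^ m) = ENNReal.ofReal
      ((m * successCount x).factorial * (m * (n - successCount x)).factorial /
        (m * n + 1).factorial) := by
  simp only [likelihood, mul_pow, ← pow_mul', lintegral_pow_mul_one_sub_pow, ← mul_add,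
    Nat.add_sub_cancel' (successCount_le x)]

theorem comp_bernoulliSamples_singleton (x : Fin n → Bool) :
    (bernoulliSamples n ∘ₘ (volume : Measure I)) {x} = ENNReal.ofReal
      ((successCount x).factorial * (n - successCount x).factorial / (n + 1).factorial) := by
  rw [Measure.bind_apply (measurableSet_singleton x) (Kernel.aemeasurable _)]
  simpa only [bernoulliSamples_singleton, pow_one, one_mul] using lintegral_likelihood_pow x 1

theorem chiSqInfo_bernoulliJoint_add_one (n : ℕ) :
    chiSqInfo (bernoulliJoint n) + 1 =
      ENNReal.ofReal (((n : ℝ) + 1) / (2 * n + 1) * (4 ^ n / ((2 * n).choose n : ℝ))) := by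
  have hpos (x : Fin n → Bool) : (0 : ℝ) <
      (successCount x).factorial * (n - successCount x).factorial / (n + 1).factorial := by
    positivity
  rw [bernoulliJoint, chiSqInfo_compProd_add_one_eq_tsum, tsum_fintype,
    ← sum_choose_mul_factorial_div]
  simp only [comp_bernoulliSamples_singleton, bernoulliSamples_singleton,
    ← ENNReal.ofReal_pow (likelihood_nonneg _ _), lintegral_likelihood_pow,
    ← ENNReal.ofReal_div_of_pos (hpos _)]
  rw [← ENNReal.ofReal_sum_of_nonneg fun x _ => by positivity]
  refine congrArg ENNReal.ofReal ((sum_successCount n fun k =>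
    ((2 * k).factorial * (2 * (n - k)).factorial / (2 * n + 1).factorial : ℝ) /
      (k.factorial * (n - k).factorial / (n + 1).factorial)).trans ?_)
  simp only [nsmul_eq_mul]

/-- The maximum-likelihood envelope of the Bernoulli model: the measure whose mass at `x` is the
maximum over `w` of the likelihood of `w` given `x`. -/
noncomputable def peakMeasure (n : ℕ) : Measure (Fin n → Bool) :=
  Measure.sum fun x =>
    ENNReal.ofReal (peakLikelihood (successCount x) (n - successCount x)) • Measure.dirac x

theorem bernoulliSamples_le_peakMeasure (w : I) : bernoulliSamples n w ≤ peakMeasure n :=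
  le_sum_smul_dirac fun x => by
    rw [bernoulliSamples_singleton]
    exact ENNReal.ofReal_le_ofReal (pow_mul_one_sub_pow_le_peakLikelihood _ _ w)

theorem peakMeasure_univ_le (hn : 1 ≤ n) :
    peakMeasure n Set.univ ≤ ENNReal.ofReal (2 + √(Real.pi * n / 2)) := by
  simp only [peakMeasure, Measure.sum_apply _ MeasurableSet.univ, Measure.smul_apply,
    measure_univ, smul_eq_mul, mul_one, tsum_fintype]
  rw [← ENNReal.ofReal_sum_of_nonneg fun x _ => peakLikelihood_nonneg _ _,
    sum_successCount n fun k => peakLikelihood k (n - k)]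
  simp only [nsmul_eq_mul]
  exact ENNReal.ofReal_le_ofReal (sum_choose_mul_peakLikelihood_le hn)

instance sFinite_peakMeasure : SFinite (peakMeasure n) := by
  unfold peakMeasure
  infer_instance

theorem sampleMean_eq_successCount_div (x : Fin n → Bool) :
    sampleMean n x = successCount x / n := by
  simp [sampleMean, successCount]

theorem sum_sq_sub_sampleMean_mul_likelihood (hn : n ≠ 0) (w : I) :
    ∑ x : Fin n → Bool, ((w : ℝ) - sampleMean n x) ^ 2 * likelihood x w = w * (1 - w) / n := by
  rw [← bernstein.variance hn w]
  simp only [sampleMean_eq_successCount_div, bernstein_apply, bernstein.z]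
  rw [← Finset.sum_range (fun k => ((w : ℝ) - k / n) ^ 2 *
    ((n.choose k : ℝ) * (w : ℝ) ^ k * (1 - (w : ℝ)) ^ (n - k)))]
  refine (sum_successCount n fun k =>
    ((w : ℝ) - k / n) ^ 2 * ((w : ℝ) ^ k * (1 - (w : ℝ)) ^ (n - k))).trans ?_
  refine Finset.sum_congr rfl fun k _ => ?_
  rw [nsmul_eq_mul]
  ring

theorem absLoss_sq (w : I) (v : ℝ) : absLoss w v ^ 2 = ENNReal.ofReal ((w - v) ^ 2) := by
  rw [absLoss, ← ENNReal.ofReal_pow (abs_nonneg _), sq_abs]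

theorem lintegral_absLoss_sampleMean_sq (hn : n ≠ 0) :
    ∫⁻ z, absLoss z.1 (sampleMean n z.2) ^ 2 ∂(bernoulliJoint n) =
      ENNReal.ofReal (1 / (6 * n)) := by
  have hcond (w : I) : ∫⁻ x, absLoss w (sampleMean n x) ^ 2 ∂(bernoulliSamples n w) =
      ENNReal.ofReal (1 / n) * ENNReal.ofReal ((w : ℝ) ^ 1 * (1 - w) ^ 1) := by
    simp only [lintegral_fintype, bernoulliSamples_singleton, absLoss_sq,
      ← ENNReal.ofReal_mul (sq_nonneg _)]
    rw [← ENNReal.ofReal_sum_of_nonneg fun x _ => mul_nonneg (sq_nonneg _) (likelihood_nonneg x w),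
      sum_sq_sub_sampleMean_mul_likelihood hn, ← ENNReal.ofReal_mul (by positivity)]
    congr 1
    ring
  rw [bernoulliJoint, Measure.lintegral_compProd
    ((measurable_loss_estimator measurable_uncurry_absLoss .of_discrete).pow_const 2)]
  simp only [hcond]
  rw [lintegral_const_mul _ (by fun_prop), lintegral_pow_mul_one_sub_pow,
    ← ENNReal.ofReal_mul (by positivity)]
  congr 1
  norm_num [Nat.factorial]

theorem lintegral_absLoss_sampleMean_le (hn : n ≠ 0) :
    ∫⁻ z, absLoss z.1 (sampleMean n z.2) ∂(bernoulliJoint n) ≤ ENNReal.ofReal (1 / √(6 * n)) := by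
  have : IsProbabilityMeasure (bernoulliJoint n) := by unfold bernoulliJoint; infer_instance
  have hm := measurable_loss_estimator measurable_uncurry_absLoss
    (.of_discrete : Measurable (sampleMean n))
  refine (ENNReal.pow_le_pow_left_iff two_ne_zero).1 ?_
  calc (∫⁻ z, absLoss z.1 (sampleMean n z.2) ∂(bernoulliJoint n)) ^ 2
      ≤ ENNReal.ofReal (1 / (6 * n)) := by
        simpa only [measure_univ, one_mul, lintegral_absLoss_sampleMean_sq hn] using
          sq_lintegral_le_measure_univ_mul_lintegral_sq (μ := bernoulliJoint n) hm.aemeasurable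
    _ = ENNReal.ofReal (1 / √(6 * n)) ^ 2 := by
        rw [← ENNReal.ofReal_pow (by positivity), div_pow, one_pow, Real.sq_sqrt (by positivity)]

theorem div_chiSqInfo_add_one_le_bernoulliRisk (n : ℕ) :
    ENNReal.ofReal (2 / 27) / (chiSqInfo (bernoulliJoint n) + 1) ≤ bernoulliRisk n := by
  have h := div_chiSqInfo_add_one_le_bayesianRisk (P := bernoulliSamples n)
    measurable_uncurry_absLoss two_ne_zero smallBallProb_absLoss_volume_le
  have hconst : ENNReal.ofReal (4 / 27) = 2 * ENNReal.ofReal (2 / 27) := by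
    rw [← ENNReal.ofReal_ofNat 2, ← ENNReal.ofReal_mul zero_le_two]
    norm_num
  rwa [hconst, ENNReal.mul_div_mul_left _ _ two_ne_zero ENNReal.ofNat_ne_top] at h

theorem ofReal_seven_div_le_div_chiSqInfo_add_one (hn : 1 ≤ n) :
    ENNReal.ofReal (7 / (72 * √(Real.pi * n))) ≤
      ENNReal.ofReal (2 / 27) / (chiSqInfo (bernoulliJoint n) + 1) := by
  have hle := succ_div_mul_four_pow_div_choose_le hn
  have hchoose : (0 : ℝ) < (2 * n).choose n := by exact_mod_cast Nat.choose_pos (by lia)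
  have hpos : 0 < ((n : ℝ) + 1) / (2 * n + 1) * (4 ^ n / ((2 * n).choose n : ℝ)) := by positivity
  rw [chiSqInfo_bernoulliJoint_add_one, ← ENNReal.ofReal_div_of_pos hpos]
  refine ENNReal.ofReal_le_ofReal ?_
  calc 7 / (72 * √(Real.pi * n)) = 2 / 27 / (16 * √(Real.pi * n) / 21) := by
        field_simp
        norm_num
    _ ≤ 2 / 27 / (((n : ℝ) + 1) / (2 * n + 1) * (4 ^ n / ((2 * n).choose n : ℝ))) := by gcongr

theorem maximalLeakage_bernoulliSamples_le (hn : 1 ≤ n) (π : Measure I) :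
    maximalLeakage π (bernoulliSamples n) ≤
      ((Real.log (2 + √(Real.pi * n / 2)) : ℝ) : EReal) := by
  rw [← ENNReal.log_ofReal_of_pos (by positivity)]
  exact (maximalLeakage_le_log_measure_univ bernoulliSamples_le_peakMeasure).trans
    (ENNReal.log_le_log (peakMeasure_univ_le hn))

theorem ofReal_one_div_eight_mul_le_bernoulliRisk (hn : 1 ≤ n) :
    ENNReal.ofReal (1 / (8 * (2 + √(Real.pi * n / 2)))) ≤ bernoulliRisk n :=
  calc ENNReal.ofReal (1 / (8 * (2 + √(Real.pi * n / 2))))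
      = (4 * (2 * ENNReal.ofReal (2 + √(Real.pi * n / 2))))⁻¹ := by
        rw [one_div, ENNReal.ofReal_inv_of_pos (by positivity), ENNReal.ofReal_mul (by norm_num),
          ENNReal.ofReal_ofNat, ← mul_assoc]
        norm_num
    _ ≤ (4 * (2 * peakMeasure n Set.univ))⁻¹ := by
        gcongr
        exact peakMeasure_univ_le hn
    _ ≤ bernoulliRisk n :=
        inv_four_mul_measure_univ_le_bayesianRisk measurable_uncurry_absLoss
          smallBallProb_absLoss_volume_le bernoulliSamples_le_peakMeasure

theorem bernoulliRisk_le (hn : n ≠ 0) : bernoulliRisk n ≤ ENNReal.ofReal (1 / √(6 * n)) :=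
  (iInf₂_le (sampleMean n) .of_discrete).trans (lintegral_absLoss_sampleMean_le hn)

end BernoulliModel

theorem exists_pos_mul_one_div_sqrt_le :
    ∃ c : ℝ, 0 < c ∧ ∀ n : ℕ, 1 ≤ n →
      c * (1 / √(6 * n)) ≤ 7 / (72 * √(Real.pi * n)) ∧
      c * (1 / √(6 * n)) ≤ 1 / (8 * (2 + √(Real.pi * n / 2))) := by
  refine ⟨1 / 20, by norm_num, fun n hn => ?_⟩
  have hn_cast : (1 : ℝ) ≤ n := by exact_mod_cast hn
  have one_le_sqrt : 1 ≤ √(n : ℝ) := Real.one_le_sqrt.2 hn_cast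
  have sqrt_six_mul : 2 * √(n : ℝ) ≤ √(6 * n) := by
    rw [Real.sqrt_mul (by norm_num)]
    gcongr
    exact Real.le_sqrt_of_sq_le (by norm_num)
  have sqrt_pi_mul : √(Real.pi * n) ≤ 2 * √(n : ℝ) := by
    rw [Real.sqrt_mul Real.pi_pos.le]
    gcongr
    exact Real.sqrt_le_iff.2 ⟨zero_le_two, Real.pi_le_four.trans (by norm_num)⟩
  have sqrt_pi_mul_half : √(Real.pi * n / 2) ≤ 2 * √(n : ℝ) :=
    (Real.sqrt_le_sqrt (half_le_self (by positivity))).trans sqrt_pi_mul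
  rw [mul_one_div]
  constructor <;>
  · rw [div_le_div_iff₀ (by positivity) (by positivity)]
    linarith

theorem mainTheorem8 :
    (∀ n : ℕ, 1 ≤ n →
      chiSqInfo (bernoulliJoint n) + 1 =
          ENNReal.ofReal (((n : ℝ) + 1) / (2 * n + 1) * (4 ^ n / ((2 * n).choose n : ℝ))) ∧
      ((n : ℝ) + 1) / (2 * n + 1) * (4 ^ n / ((2 * n).choose n : ℝ)) ≤
          16 * √(Real.pi * n) / 21 ∧
      ENNReal.ofReal (2 / 27) / (chiSqInfo (bernoulliJoint n) + 1) ≤ bernoulliRisk n ∧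
      ENNReal.ofReal (7 / (72 * √(Real.pi * n))) ≤
          ENNReal.ofReal (2 / 27) / (chiSqInfo (bernoulliJoint n) + 1) ∧
      maximalLeakage (volume : Measure I) (bernoulliSamples n) ≤
          ((Real.log (2 + √(Real.pi * n / 2)) : ℝ) : EReal) ∧
      ENNReal.ofReal (1 / (8 * (2 + √(Real.pi * n / 2)))) ≤ bernoulliRisk n ∧
      ∫⁻ z, absLoss z.1 (sampleMean n z.2) ∂(bernoulliJoint n) ≤
          ENNReal.ofReal (1 / √(6 * n)) ∧
      bernoulliRisk n ≤ ENNReal.ofReal (1 / √(6 * n))) ∧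
    (∃ c : ℝ, 0 < c ∧ ∀ n : ℕ, 1 ≤ n →
      c * (1 / √(6 * n)) ≤ 7 / (72 * √(Real.pi * n)) ∧
      c * (1 / √(6 * n)) ≤ 1 / (8 * (2 + √(Real.pi * n / 2)))) := by
  refine ⟨fun n hn => ?_, exists_pos_mul_one_div_sqrt_le⟩
  have hn_ne : n ≠ 0 := Nat.one_le_iff_ne_zero.1 hn
  exact ⟨chiSqInfo_bernoulliJoint_add_one n,
    succ_div_mul_four_pow_div_choose_le hn,
    div_chiSqInfo_add_one_le_bernoulliRisk n,
    ofReal_seven_div_le_div_chiSqInfo_add_one hn,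
    maximalLeakage_bernoulliSamples_le hn volume,
    ofReal_one_div_eight_mul_le_bernoulliRisk hn,
    lintegral_absLoss_sampleMean_le hn_ne,
    bernoulliRisk_le hn_ne⟩
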